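/- Let $\mathbb K$ be an algebraically closed field of characteristic $0$ and $n\ge 1$. Let $\mathrm U(n)=\mathbb K[\tilde h_1,\dots,\tilde h_n]$, put $\tilde h_{ij}=\tilde h_i-\tilde h_j$, and let $\bar{\mathrm U}(n)$ be the localization of $\mathrm U(n)$ at the multiplicative set generated by all $\tilde h_{ij}+k$ with $i\neq j$, $k\in\mathbb Z$. For $f\in\bar{\mathrm U}(n)$ let $f[-\varepsilon_j]$ be obtained from $f$ by $\tilde h_j\mapsto\tilde h_j-1$, and let $\Delta_jf=f-f[-\varepsilon_j]$. Put $\chi_j=\prod_{k\neq j}\tilde h_{jk}$, $\mathcal W_j=\{\pi(\tilde h_j)/\chi_j : \pi\in\mathbb K[t]\}\subset\bar{\mathrm U}(n)$, $\mathcal H'=\bigoplus_{j\ge1}\mathbb K H_j$, where $H_j$ is the complete symmetric polynomial of degree $j$ in $\tilde h_1,\dots,\tilde h_n$, and $\mathcal W'=\bigoplus_{j\neq1}\mathcal W_j\oplus\mathcal H'\subset\bar{\mathrm U}(n)$. For $\sigma\in\bar{\mathrm U}(n)$ let $\sigma_i=\Delta_i\sigma$, and let $\mathrm{Diff}_{\mathbf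 h,\sigma}(n)$ be the $\mathbb K$-algebra generated by $\bar{\mathrm U}(n)$ and elements $x^i,\bar\partial_i$, $i=1,\dots,n$, with the defining relations $$\tilde h_ix^j=x^j(\tilde h_i+\delta_{ij}),\qquad \tilde h_i\bar\partial_j=\bar\partial_j(\tilde h_i-\delta_{ij}),$$ $$x^ix^j=\frac{\tilde h_{ij}+1}{\tilde h_{ij}}x^jx^i,\qquad \bar\partial_i\bar\partial_j=\frac{\tilde h_{ij}-1}{\tilde h_{ij}}\bar\partial_j\bar\partial_i\qquad(i<j),$$ $$x^i\bar\partial_j=\bar\partial_jx^i\ (i<j),\qquad x^i\bar\partial_j=\frac{\tilde h_{ij}(\tilde h_{ij}-2)}{(\tilde h_{ij}-1)^2}\bar\partial_jx^i\ (i>j),$$ $$x^i\bar\partial_i=\sum_{j=1}^n\frac1{1-\tilde h_{ij}}\bar\partial_jx^j-\sigma_i .$$ It is filtered by giving the elements of $\bar{\mathrm U}(n)$ degree $0$ and each $x^i$, $\bar\partial_i$ degree $1$: the $k$-th term is spanned by the products of generators of total degree at most $k$. Let $\sigma,\sigma'\in\mathcal W'$. Then $\mathrm{Diff}_{\mathbf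 h,\sigma}(n)$ and $\mathrm{Diff}_{\mathbf h,\sigma'}(n)$ are isomorphic as filtered rings over $\bar{\mathrm U}(n)$ (that is, there is a ring isomorphism which is the identity on $\bar{\mathrm U}(n)$ and maps each term of the filtration onto the corresponding term) if and only if $\sigma'=\gamma\sigma$ for some $\gamma\in\mathbb K$, $\gamma\neq0$. -/

import Mathlib

open MvPolynomial Finset

namespace HDiff

noncomputable section

/-- The enveloping algebra `U(n)` of the abelian Lie algebra with basis `h̃₁, …, h̃ₙ`:
the polynomial ring in `n` variables. The index set `{1, …, n}` is `Fin n`. -/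
abbrev U (K : Type*) [Field K] (n : ℕ) : Type _ := MvPolynomial (Fin n) K

/-- The multiplicative set generated by `h̃ᵢ - h̃ⱼ + k`, `i ≠ j`, `k ∈ ℤ`. -/
def denoms (K : Type*) [Field K] (n : ℕ) : Submonoid (U K n) :=
  Submonoid.closure {p | ∃ i j : Fin n, i ≠ j ∧ ∃ k : ℤ, p = X i - X j + (k : U K n)}

/-- The ring of fractions `Ū(n)`. -/
abbrev UBar (K : Type*) [Field K] (n : ℕ) : Type _ := Localization (denoms K n)

variable (K : Type*) [Field K] (n : ℕ)

/-- The generator `h̃ᵢ` as an element of `Ū(n)`. -/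
def h (i : Fin n) : UBar K n := algebraMap (U K n) (UBar K n) (X i)

/-- `h̃ᵢⱼ = h̃ᵢ - h̃ⱼ`. -/
def hh (i j : Fin n) : UBar K n := h K n i - h K n j

/-- The elements `h̃ᵢⱼ + k` with `i ≠ j` are invertible, so that `Ring.inverse` is their true
inverse wherever it is used below. -/
theorem isUnit_hh_add (i j : Fin n) (hij : i ≠ j) (k : ℤ) :
    IsUnit (hh K n i j + (k : UBar K n)) := by
  have hm : (X i - X j + (k : U K n)) ∈ denoms K n :=
    Submonoid.subset_closure ⟨i, j, hij, k, rfl⟩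
  have hu := IsLocalization.map_units (UBar K n) (⟨_, hm⟩ : denoms K n)
  simpa [hh, h] using hu

/-- The translation `h̃ᵢ ↦ h̃ᵢ + cᵢ` of `U(n)`. -/
def shiftPoly (c : Fin n → ℤ) : U K n →ₐ[K] U K n :=
  aeval fun i => X i + (c i : U K n)

theorem denoms_le_comap (c : Fin n → ℤ) :
    denoms K n ≤ (denoms K n).comap (shiftPoly K n c : U K n →+* U K n) := by
  unfold denoms
  rw [Submonoid.closure_le]
  rintro p ⟨i, j, hij, k, rfl⟩
  refine Submonoid.subset_closure ⟨i, j, hij, k + c i - c j, ?_⟩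
  simp [shiftPoly]
  ring

/-- The translation `h̃ᵢ ↦ h̃ᵢ + cᵢ` of `Ū(n)`, written `f ↦ f[∑ cᵢ εᵢ]`. -/
def shift (c : Fin n → ℤ) : UBar K n →+* UBar K n :=
  IsLocalization.map (UBar K n) (shiftPoly K n c : U K n →+* U K n) (denoms_le_comap K n c)

/-- The finite difference operator `Δⱼ f = f - f[-εⱼ]`. -/
def Delta (j : Fin n) (f : UBar K n) : UBar K n :=
  f - shift K n (-Pi.single j 1) f

/-- `χᵢ = ∏_{k ≠ i} h̃ᵢₖ`. -/
def chi (i : Fin n) : UBar K n := ∏ k ∈ univ.erase i, hh K n i k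

theorem isUnit_chi (i : Fin n) : IsUnit (chi K n i) := by
  unfold chi
  rw [IsUnit.prod_iff]
  intro k hk
  simpa using isUnit_hh_add K n i k (Finset.ne_of_mem_erase hk).symm 0

/-- The `K`-subspace `𝒲ⱼ` of the elements `π(h̃ⱼ) / χⱼ`, where `π ∈ K[t]`. -/
def W (j : Fin n) : Submodule K (UBar K n) :=
  LinearMap.range (LinearMap.mulRight K (Ring.inverse (chi K n j)) ∘ₗ
    (Polynomial.aeval (R := K) (h K n j)).toLinearMap)

/-- The `K`-span `ℋ'` of the complete symmetric polynomials `Hⱼ(h̃₁, …, h̃ₙ)` with `j ≥ 1`. -/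
def HPrime : Submodule K (UBar K n) :=
  Submodule.span K
    {f | ∃ j : ℕ, 1 ≤ j ∧ f = algebraMap (U K n) (UBar K n) (hsymm (Fin n) K j)}

/-- `𝒲' = ⨁_{j ≠ 1} 𝒲ⱼ ⊕ ℋ'`; the first index is `0 : Fin n`. -/
def WPrime [NeZero n] : Submodule K (UBar K n) :=
  (⨆ (j : Fin n) (_ : j ≠ 0), W K n j) ⊔ HPrime K n

/-- Generators of the ring: the elements of `Ū(n)`, the `xⁱ` and the `∂̄ᵢ`. -/
inductive Gen where
  | u (f : UBar K n) : Gen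
  | x (i : Fin n) : Gen
  | d (i : Fin n) : Gen

/-- The degree: elements of `Ū(n)` have degree `0`, the `xⁱ` and the `∂̄ᵢ` have degree `1`. -/
def Gen.deg : Gen K n → ℕ
  | .u _ => 0
  | .x _ => 1
  | .d _ => 1

/-- Generators in the free algebra. -/
abbrev fu (f : UBar K n) : FreeAlgebra K (Gen K n) := FreeAlgebra.ι K (Gen.u f)
abbrev fx (i : Fin n) : FreeAlgebra K (Gen K n) := FreeAlgebra.ι K (Gen.x i)
abbrev fd (i : Fin n) : FreeAlgebra K (Gen K n) := FreeAlgebra.ι K (Gen.d i)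

/-- The defining relations of the ring `Diff_h(σ₁, …, σₙ)`. The first three say that
`Ū(n)` maps to the ring by a homomorphism of `K`-algebras. -/
inductive Rel (s : Fin n → UBar K n) :
    FreeAlgebra K (Gen K n) → FreeAlgebra K (Gen K n) → Prop
  | add (f g : UBar K n) : Rel s (fu K n (f + g)) (fu K n f + fu K n g)
  | mul (f g : UBar K n) : Rel s (fu K n (f * g)) (fu K n f * fu K n g)
  | scalar (c : K) : Rel s (fu K n (algebraMap K (UBar K n) c)) (algebraMap K _ c)
  | weight_x (i j : Fin n) :
      Rel s (fu K n (h K n i) * fx K n j)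
        (fx K n j * fu K n (h K n i + if i = j then 1 else 0))
  | weight_d (i j : Fin n) :
      Rel s (fu K n (h K n i) * fd K n j)
        (fd K n j * fu K n (h K n i - if i = j then 1 else 0))
  | xx (i j : Fin n) (hij : i < j) :
      Rel s (fx K n i * fx K n j)
        (fu K n ((hh K n i j + 1) * Ring.inverse (hh K n i j)) * (fx K n j * fx K n i))
  | dd (i j : Fin n) (hij : i < j) :
      Rel s (fd K n i * fd K n j)
        (fu K n ((hh K n i j - 1) * Ring.inverse (hh K n i j)) * (fd K n j * fd K n i))
  | xd_lt (i j : Fin n) (hij : i < j) :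
      Rel s (fx K n i * fd K n j) (fd K n j * fx K n i)
  | xd_gt (i j : Fin n) (hij : j < i) :
      Rel s (fx K n i * fd K n j)
        (fu K n (hh K n i j * (hh K n i j - 2) * Ring.inverse ((hh K n i j - 1) ^ 2)) *
          (fd K n j * fx K n i))
  | xd_eq (i : Fin n) :
      Rel s (fx K n i * fd K n i)
        ((∑ j, fu K n (Ring.inverse (1 - hh K n i j)) * (fd K n j * fx K n j)) -
          fu K n (s i))

/-- The ring `Diff_h(σ₁, …, σₙ)` over `Ū(n)`. -/
abbrev DiffTuple (s : Fin n → UBar K n) : Type _ := RingQuot (Rel K n s)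

/-- The ring `Diff_{h,σ}(n)`, with `σᵢ = Δᵢ σ`. -/
abbrev Diff (σ : UBar K n) : Type _ := DiffTuple K n fun i => Delta K n i σ

/-- The image of a generator in `Diff_{h,σ}(n)`. -/
def gen (σ : UBar K n) (g : Gen K n) : Diff K n σ :=
  RingQuot.mkAlgHom K (Rel K n fun i => Delta K n i σ) (FreeAlgebra.ι K g)

/-- The structure homomorphism `Ū(n) → Diff_{h,σ}(n)`. -/
def coeff (σ : UBar K n) : UBar K n →+* Diff K n σ where
  toFun f := gen K n σ (Gen.u f)
  map_one' := by
    have := RingQuot.mkAlgHom_rel K (Rel.scalar (s := fun i => Delta K n i σ) (1 : K))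
    simpa [gen, fu] using this
  map_zero' := by
    have := RingQuot.mkAlgHom_rel K (Rel.scalar (s := fun i => Delta K n i σ) (0 : K))
    simpa [gen, fu] using this
  map_add' f g := by
    have := RingQuot.mkAlgHom_rel K (Rel.add (s := fun i => Delta K n i σ) f g)
    simpa [gen, fu] using this
  map_mul' f g := by
    have := RingQuot.mkAlgHom_rel K (Rel.mul (s := fun i => Delta K n i σ) f g)
    simpa [gen, fu] using this

/-- The ascending filtration given by the degrees of the generators: its `k`-th term is the span
of the products of generators of total degree at most `k`. -/
def filtration (σ : UBar K n) (k : ℕ) : Submodule K (Diff K n σ) :=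
  Submodule.span K
    {a | ∃ l : List (Gen K n), (l.map (Gen.deg K n)).sum ≤ k ∧ a = (l.map (gen K n σ)).prod}

/-- `Diff_{h,σ}(n)` and `Diff_{h,σ'}(n)` are isomorphic as filtered rings over `Ū(n)`: there is
a ring isomorphism that is the identity on `Ū(n)` and maps each term of the filtration onto the
corresponding one. -/
def FilteredIso (σ σ' : UBar K n) : Prop :=
  ∃ φ : Diff K n σ ≃+* Diff K n σ',
    (∀ f : UBar K n, φ (coeff K n σ f) = coeff K n σ' f) ∧
    ∀ (k : ℕ) (a : Diff K n σ), φ a ∈ filtration K n σ' k ↔ a ∈ filtration K n σ k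

end

end HDiff

/-! If `σ = c • σ'`, sending `xⁱ` to `c xⁱ` and fixing the other generators respects all relations,
which gives one direction.

Conversely, an isomorphism over `Ū(n)` preserves the weights of commutation with the `h̃ᵢ`. As it
also preserves the filtration, it sends `xⁱ` to `μᵢ xⁱ` and `∂̄ᵢ` to `νᵢ ∂̄ᵢ`, with coefficients in
`Ū(n)`. Then `∂̄ⱼxʲ` goes to `Aⱼ ∂̄ⱼxʲ` with `Aⱼ = νⱼ μⱼ[εⱼ]`, and `xⁱ∂̄ᵢ` is multiplied by
`Aᵢ[-εᵢ]`. Comparing coefficients in the image of the relation for `xⁱ∂̄ᵢ` yields `Aᵢ[-εᵢ] = Aⱼ` for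
all `i, j` and `Δᵢσ = Aᵢ[-εᵢ] Δᵢσ'`. So all `Aⱼ` equal one translation-invariant element, a scalar
`a` (`exists_scalar_of_shift_eq`), and `σ - aσ'` is invariant too, hence a scalar. It lies in `𝒲'`,
which meets `K` only in `0` (`eq_zero_of_scalar_mem_WPrime`).

Comparing coefficients requires `1` and the `∂̄ⱼxʲ` to be left independent over `Ū(n)`
(`eq_zero_of_sum_d_mul_x`). No PBW theorem is used: each choice of polynomials `wⱼ` with `Δᵢ(∑
wⱼ(h̃ⱼ)/χⱼ) = Δᵢσ` gives a representation on `Ū(n)` by weighted translations (`rep`), in which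
`∂̄ⱼxʲ` multiplies by `wⱼ(h̃ⱼ)/χⱼ`. Adding `tᵏ`, `k < n`, to every `wⱼ` changes the sum by a
constant, so it gives another representation of the same ring; these `n + 1` representations
separate the coefficients by a Vandermonde argument. -/

namespace HDiff

noncomputable section

/-! ### Translations of `Ū(n)` and products of linear factors -/

section Translations

variable {K : Type*} [Field K] {n : ℕ}

theorem denoms_le_nonZeroDivisors : denoms K n ≤ nonZeroDivisors (U K n) := by
  unfold denoms
  rw [Submonoid.closure_le]
  rintro p ⟨i, j, hij, k, rfl⟩
  refine mem_nonZeroDivisors_of_ne_zero fun h0 => ?_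
  -- At this point `h̃ᵢ - h̃ⱼ + k` takes the value `1`.
  have h1 := congrArg (eval (Pi.single i (1 - (k : K)))) h0
  simp [hij.symm] at h1

instance : IsDomain (UBar K n) :=
  IsLocalization.isDomain_localization denoms_le_nonZeroDivisors

theorem algebraMap_injective : Function.Injective (algebraMap (U K n) (UBar K n)) :=
  IsLocalization.injective _ denoms_le_nonZeroDivisors

theorem shift_algebraMap (c : Fin n → ℤ) (p : U K n) :
    shift K n c (algebraMap (U K n) (UBar K n) p) = algebraMap _ _ (shiftPoly K n c p) :=
  IsLocalization.map_eq _ _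

@[simp] theorem shift_h (c : Fin n → ℤ) (i : Fin n) :
    shift K n c (h K n i) = h K n i + (c i : UBar K n) := by
  simp [h, shift_algebraMap, shiftPoly]

@[simp] theorem shift_hh (c : Fin n → ℤ) (i j : Fin n) :
    shift K n c (hh K n i j) = hh K n i j + (c i : UBar K n) - (c j : UBar K n) := by
  simp [hh]; ring

@[simp] theorem shift_scalar (c : Fin n → ℤ) (a : K) :
    shift K n c (algebraMap K (UBar K n) a) = algebraMap K (UBar K n) a := by
  rw [IsScalarTower.algebraMap_apply K (U K n) (UBar K n), shift_algebraMap]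
  simp [shiftPoly]

@[simp] theorem shift_smul (c : Fin n → ℤ) (a : K) (f : UBar K n) :
    shift K n c (a • f) = a • shift K n c f := by
  simp [Algebra.smul_def]

/-- Ring homomorphisms out of `Ū(n)` that agree on the scalars and the `h̃ᵢ` are equal. -/
theorem ringHom_ext {R : Type*} [CommRing R] {f g : UBar K n →+* R}
    (hK : ∀ a : K, f (algebraMap K _ a) = g (algebraMap K _ a))
    (hh : ∀ i, f (h K n i) = g (h K n i)) : f = g := by
  refine IsLocalization.ringHom_ext (denoms K n) ?_
  refine MvPolynomial.ringHom_ext (fun a => ?_) hh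
  have := hK a
  rwa [IsScalarTower.algebraMap_apply K (U K n) (UBar K n)] at this

theorem shift_shift (c d : Fin n → ℤ) (f : UBar K n) :
    shift K n c (shift K n d f) = shift K n (c + d) f := by
  have : (shift K n c).comp (shift K n d) = shift K n (c + d) :=
    ringHom_ext (by simp) (by intro i; simp; ring)
  exact congrArg (fun F : UBar K n →+* UBar K n => F f) this

@[simp] theorem shift_zero (f : UBar K n) : shift K n 0 f = f := by
  have : shift K n 0 = RingHom.id (UBar K n) := ringHom_ext (by simp) (by simp)
  simp [this]

theorem isUnit_shift (c : Fin n → ℤ) {f : UBar K n} (hf : IsUnit f) :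
    IsUnit (shift K n c f) := hf.map _

theorem map_inverse_of_isUnit {R S : Type*} [CommRing R] [CommRing S] (f : R →+* S) {a : R}
    (ha : IsUnit a) : f (Ring.inverse a) = Ring.inverse (f a) := by
  rw [← one_mul (Ring.inverse (f a)), Ring.eq_mul_inverse_iff_mul_eq _ _ _ (ha.map f), ← map_mul,
    Ring.inverse_mul_cancel _ ha, map_one]

theorem hh_ne_zero {i j : Fin n} (hij : i ≠ j) (k : ℤ) : hh K n i j + (k : UBar K n) ≠ 0 :=
  (isUnit_hh_add K n i j hij k).ne_zero

theorem h_injective : Function.Injective (h K n) := fun i j hij => by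
  by_contra hne
  exact hh_ne_zero (K := K) hne 0 (by simp [hh, hij])

/-- A product of factors `h̃ᵢₖ + c`. -/
def linProd (i : Fin n) (s : Finset (Fin n)) (c : ℤ) : UBar K n :=
  ∏ k ∈ s, (hh K n i k + (c : UBar K n))

theorem isUnit_linProd (i : Fin n) {s : Finset (Fin n)} (hi : i ∉ s) (c : ℤ) :
    IsUnit (linProd i s c : UBar K n) := by
  rw [linProd, IsUnit.prod_iff]
  exact fun k hk => isUnit_hh_add K n i k (fun e => hi (e ▸ hk)) c

theorem shift_linProd_of_notMem {i j : Fin n} (hij : i ≠ j) {s : Finset (Fin n)} (hj : j ∉ s)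
    (c m : ℤ) :
    shift K n (Pi.single j m) (linProd i s c) = linProd i s c := by
  rw [linProd, map_prod]
  refine prod_congr rfl fun k hk => ?_
  have : k ≠ j := fun e => hj (e ▸ hk)
  simp [hij, this]

/-- Only the factor with `k = j` moves. Like the later translation rules, this is kept free of
denominators so that it can feed `linear_combination`. -/
theorem shift_linProd_of_mem {i j : Fin n} (hij : i ≠ j) {s : Finset (Fin n)} (hj : j ∈ s)
    (c m : ℤ) :
    shift K n (Pi.single j m) (linProd i s c) * (hh K n i j + (c : UBar K n)) =
      linProd i s c * (hh K n i j + (c : UBar K n) - (m : UBar K n)) := by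
  have h1 : (linProd i s c : UBar K n) =
      (hh K n i j + (c : UBar K n)) * linProd i (s.erase j) c := by
    rw [linProd, linProd, mul_prod_erase s (fun k => hh K n i k + (c : UBar K n)) hj]
  rw [h1, map_mul, shift_linProd_of_notMem hij (notMem_erase j s)]
  simp [hij]
  ring

theorem shift_self_linProd (i : Fin n) {s : Finset (Fin n)} (hi : i ∉ s) (c m : ℤ) :
    shift K n (Pi.single i m) (linProd i s c) = linProd i s (c + m) := by
  rw [linProd, linProd, map_prod]
  refine prod_congr rfl fun k hk => ?_
  have : k ≠ i := fun e => hi (e ▸ hk)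
  simp [this]
  ring

theorem chi_eq_linProd (i : Fin n) : chi K n i = linProd i (univ.erase i) 0 := by
  simp [chi, linProd]

end Translations

/-! ### Complete symmetric polynomials as divided differences -/

/-- `H_{k+1}(a, v) = a H_k(a, v) + H_{k+1}(v)`. -/
theorem hsymm_option_succ {α R : Type*} [Fintype α] [DecidableEq α] [CommRing R] (k : ℕ) :
    hsymm (Option α) R (k + 1) =
      X none * hsymm (Option α) R k + rename some (hsymm α R (k + 1)) := by
  rw [hsymm, ← symOptionSuccEquiv.symm.sum_comp, Fintype.sum_sum_type, hsymm, hsymm, mul_sum,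
    map_sum]
  congr 1
  · refine sum_congr rfl fun s _ => ?_
    simp [symOptionSuccEquiv, Sym.coe_cons]
  · refine sum_congr rfl fun s _ => ?_
    simp [symOptionSuccEquiv, map_multiset_prod, Multiset.map_map]

/-- The divided difference of `t ^ m` at the points `v j`. -/
def divDiff {α F : Type*} [Fintype α] [DecidableEq α] [Field F] (v : α → F) (m : ℕ) : F :=
  ∑ j, v j ^ m / ∏ k ∈ univ.erase j, (v j - v k)

/-- Below the number of points, `t ^ m` is its own Lagrange interpolant, and the divided difference
is the top coefficient of that interpolant. -/
theorem divDiff_of_lt {α F : Type*} [Fintype α] [DecidableEq α] [Field F] {v : α → F}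
    (hv : Function.Injective v) {m : ℕ} (hm : m < Fintype.card α) :
    divDiff v m = if m = Fintype.card α - 1 then 1 else 0 := by
  have := Lagrange.coeff_eq_sum (s := univ) (v := v) hv.injOn (P := Polynomial.X ^ m)
    (by rw [Polynomial.degree_X_pow, card_univ]; exact_mod_cast hm)
  simp only [Polynomial.coeff_X_pow, card_univ, Polynomial.eval_pow, Polynomial.eval_X] at this
  rw [divDiff, ← this]
  simp [eq_comm]

/-- In the term of `some j`, the factor `v (some j) - v none` of `v (some j) ^ (m + 1) - v none * v
(some j) ^ m` cancels against the denominator. This is the same recursion as `hsymm_option_succ`. -/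
theorem divDiff_option_succ {α F : Type*} [Fintype α] [DecidableEq α] [Field F]
    {v : Option α → F} (hv : Function.Injective v) (m : ℕ) :
    divDiff v (m + 1) = v none * divDiff v m + divDiff (v ∘ some) m := by
  have h1 : ∀ j : α, ∏ k ∈ univ.erase (some j), (v (some j) - v k) =
      (v (some j) - v none) * ∏ k ∈ univ.erase j, (v (some j) - v (some k)) := by
    intro j
    have : (univ.erase (some j) : Finset (Option α)) =
        insert none ((univ.erase j).map Function.Embedding.some) := by
      ext x; cases x <;> simp
    rw [this, prod_insert (by simp), prod_map]
    rfl
  simp only [divDiff, Fintype.sum_option, h1, mul_add, mul_sum, Function.comp]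
  rw [add_assoc, ← sum_add_distrib]
  congr 1
  · ring
  · refine sum_congr rfl fun j _ => ?_
    have h2 : v (some j) - v none ≠ 0 := sub_ne_zero.2 fun e => by simpa using hv e
    have h3 : ∏ k ∈ univ.erase j, (v (some j) - v (some k)) ≠ 0 :=
      prod_ne_zero_iff.2 fun k hk => sub_ne_zero.2 fun e =>
        (ne_of_mem_erase hk) (by simpa using (hv e).symm)
    field_simp
    ring

theorem divDiff_comp_equiv {α β F : Type*} [Fintype α] [DecidableEq α] [Fintype β] [DecidableEq β]
    [Field F] (e : α ≃ β) (v : β → F) (m : ℕ) : divDiff (v ∘ e) m = divDiff v m := by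
  rw [divDiff, divDiff, ← e.sum_comp]
  refine sum_congr rfl fun j _ => ?_
  have : (univ.erase (e j) : Finset β) = (univ.erase j).map e.toEmbedding := by
    ext x; simp [← e.symm_apply_eq, eq_comm]
  rw [this, prod_map]
  rfl

theorem eval_hsymm_eq_divDiff_fin {F : Type*} [Field F] (n : ℕ) :
    ∀ (v : Fin (n + 1) → F), Function.Injective v → ∀ k,
      eval v (hsymm (Fin (n + 1)) F k) = divDiff v (k + n) := by
  induction n with
  | zero =>
    rw [zero_add]
    intro v hv k
    induction k with
    | zero => rw [hsymm_zero, divDiff_of_lt hv] <;> simp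
    | succ k _ =>
      rw [hsymm, Fintype.sum_unique, divDiff, Fintype.sum_unique,
        Sym.eq_replicate_of_subsingleton 0 (default : Sym (Fin 1) (k + 1))]
      simp [Sym.coe_replicate, pow_succ']
  | succ n ih =>
    intro v hv k
    let e : Option (Fin (n + 1)) ≃ Fin (n + 2) := (_root_.finSuccEquiv (n + 1)).symm
    have hve : Function.Injective (v ∘ e) := hv.comp e.injective
    rw [← divDiff_comp_equiv e, ← rename_hsymm _ _ _ e, eval_rename]
    induction k with
    | zero => rw [hsymm_zero, divDiff_of_lt hve] <;> simp
    | succ k ihk =>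
      rw [hsymm_option_succ, map_add, map_mul, eval_X, ihk, eval_rename,
        ih _ (hve.comp (Option.some_injective _)), show k + 1 + (n + 1) = (k + (n + 1)) + 1 by ring,
        divDiff_option_succ hve, show k + 1 + n = k + (n + 1) by ring]

theorem eval_hsymm_eq_divDiff {F : Type*} [Field F] (n : ℕ) [NeZero n] {v : Fin n → F}
    (hv : Function.Injective v) (k : ℕ) :
    eval v (hsymm (Fin n) F k) = divDiff v (k + (n - 1)) := by
  obtain ⟨m, rfl⟩ : ∃ m, n = m + 1 := ⟨n - 1, (Nat.sub_add_cancel NeZero.one_le).symm⟩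
  exact eval_hsymm_eq_divDiff_fin m v hv k

/-! ### Representations by weighted translations -/

variable {K : Type*} [Field K] {n : ℕ}

/-- The translation of `Ū(n)` as a homomorphism of `K`-algebras. -/
def shiftAlgHom (c : Fin n → ℤ) : UBar K n →ₐ[K] UBar K n :=
  { shift K n c with commutes' := shift_scalar c }

theorem shiftAlgHom_apply (c : Fin n → ℤ) (f : UBar K n) : shiftAlgHom c f = shift K n c f := rfl

/-- The weighted translation `v ↦ a v[c]`. -/
def act (a : UBar K n) (c : Fin n → ℤ) : Module.End K (UBar K n) :=
  LinearMap.mulLeft K a ∘ₗ (shiftAlgHom c).toLinearMap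

theorem act_apply (a : UBar K n) (c : Fin n → ℤ) (v : UBar K n) :
    act a c v = a * shift K n c v := rfl

theorem act_mul_act (a b : UBar K n) (c d : Fin n → ℤ) :
    act a c * act b d = act (a * shift K n c b) (c + d) := by
  ext v
  simp [Module.End.mul_apply, act_apply, shift_shift, mul_assoc]

theorem act_add (a b : UBar K n) (c : Fin n → ℤ) : act (a + b) c = act a c + act b c := by
  ext v
  simp [act_apply, add_mul]

theorem act_sub (a b : UBar K n) (c : Fin n → ℤ) : act (a - b) c = act a c - act b c := by
  ext v
  simp [act_apply, sub_mul]

theorem act_sum {ι : Type*} (s : Finset ι) (a : ι → UBar K n) (c : Fin n → ℤ) :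
    act (∑ i ∈ s, a i) c = ∑ i ∈ s, act (a i) c := by
  ext v
  simp [act_apply, sum_mul, LinearMap.sum_apply]

theorem act_scalar (a : K) :
    act (algebraMap K (UBar K n) a) 0 = algebraMap K (Module.End K (UBar K n)) a := by
  ext v
  simp [act_apply, Algebra.smul_def]

/-- The element `w(h̃ᵢ) / χᵢ` of `𝒲ᵢ`. -/
def frac (i : Fin n) (w : Polynomial K) : UBar K n :=
  Polynomial.aeval (h K n i) w * Ring.inverse (chi K n i)

theorem shift_aeval_h {i j : Fin n} (hij : i ≠ j) (m : ℤ) (w : Polynomial K) :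
    shift K n (Pi.single j m) (Polynomial.aeval (h K n i) w) = Polynomial.aeval (h K n i) w := by
  rw [← shiftAlgHom_apply, ← Polynomial.aeval_algHom_apply, shiftAlgHom_apply]
  simp [hij]

/-- Translating `h̃ⱼ` with `j ≠ i` fixes the numerator and changes only the factor `h̃ᵢⱼ` of `χᵢ`.
-/
theorem shift_frac_mul {i j : Fin n} (hij : i ≠ j) (m : ℤ) (w : Polynomial K) :
    shift K n (Pi.single j m) (frac i w) * (hh K n i j - (m : UBar K n)) =
      frac i w * hh K n i j := by
  have hc := shift_linProd_of_mem (K := K) hij (mem_erase.2 ⟨hij.symm, mem_univ j⟩) 0 m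
  rw [← chi_eq_linProd] at hc
  simp only [Int.cast_zero, add_zero] at hc
  have hu := isUnit_chi K n i
  have hu' := isUnit_shift (Pi.single j m) hu
  rw [frac, map_mul, shift_aeval_h hij, map_inverse_of_isUnit _ hu]
  apply (hu.mul hu').mul_left_cancel
  have e1 := Ring.mul_inverse_cancel _ hu
  have e2 := Ring.mul_inverse_cancel _ hu'
  linear_combination (Polynomial.aeval (h K n i) w) *
    (chi K n i * (hh K n i j - (m : UBar K n)) * e2 -
     shift K n (Pi.single j m) (chi K n i) * hh K n i j * e1 - hc)

/-- The coefficient of the operator by which `xⁱ` acts. -/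
def wtX (i : Fin n) : UBar K n := Ring.inverse (linProd i (Ioi i) 0)

/-- The coefficient of the operator by which `∂̄ᵢ` acts. -/
def wtD (w : Fin n → Polynomial K) (i : Fin n) : UBar K n :=
  frac i (w i) * linProd i (Ioi i) 1

theorem isUnit_linProd_Ioi (i : Fin n) (c : ℤ) : IsUnit (linProd i (Ioi i) c : UBar K n) :=
  isUnit_linProd i (by simp) c

theorem shift_wtX (i : Fin n) (c : Fin n → ℤ) :
    shift K n c (wtX i) = Ring.inverse (shift K n c (linProd i (Ioi i) 0)) :=
  map_inverse_of_isUnit _ (isUnit_linProd_Ioi i 0)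

theorem wtX_mul_shift_of_lt {i j : Fin n} (hij : i < j) (m : ℤ) :
    shift K n (Pi.single j m) (wtX i) * (hh K n i j - (m : UBar K n)) =
      wtX i * hh K n i j := by
  have hc := shift_linProd_of_mem (K := K) hij.ne (mem_Ioi.2 hij) 0 m
  simp only [Int.cast_zero, add_zero] at hc
  have hu := isUnit_linProd_Ioi (K := K) i 0
  have hu' := isUnit_shift (Pi.single j m) hu
  rw [shift_wtX, wtX]
  apply (hu.mul hu').mul_left_cancel
  have e1 := Ring.mul_inverse_cancel _ hu
  have e2 := Ring.mul_inverse_cancel _ hu'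
  linear_combination (linProd i (Ioi i) 0) * (hh K n i j - (m : UBar K n)) * e2 -
     shift K n (Pi.single j m) (linProd i (Ioi i) 0) * hh K n i j * e1 - hc

theorem shift_wtX_of_gt {i j : Fin n} (hij : j < i) (m : ℤ) :
    shift K n (Pi.single j m) (wtX i) = (wtX i : UBar K n) := by
  rw [shift_wtX, shift_linProd_of_notMem hij.ne' (by simpa using hij.le), wtX]

theorem wtD_mul_shift_of_lt (w : Fin n → Polynomial K) {i j : Fin n} (hij : i < j) (m : ℤ) :
    shift K n (Pi.single j m) (wtD w i) * ((hh K n i j - (m : UBar K n)) * (hh K n i j + 1)) =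
      wtD w i * (hh K n i j * (hh K n i j + 1 - m)) := by
  have h1 := shift_frac_mul hij.ne m (w i)
  have h2 := shift_linProd_of_mem (K := K) hij.ne (mem_Ioi.2 hij) 1 m
  rw [Int.cast_one] at h2
  rw [wtD, map_mul]
  linear_combination shift K n (Pi.single j m) (linProd i (Ioi i) 1) * (hh K n i j + 1) * h1 +
    frac i (w i) * hh K n i j * h2

theorem wtD_mul_shift_of_gt (w : Fin n → Polynomial K) {i j : Fin n} (hij : j < i) (m : ℤ) :
    shift K n (Pi.single j m) (wtD w i) * (hh K n i j - (m : UBar K n)) =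
      wtD w i * hh K n i j := by
  have h1 := shift_frac_mul hij.ne' m (w i)
  rw [wtD, map_mul, shift_linProd_of_notMem hij.ne' (by simpa using hij.le)]
  linear_combination linProd i (Ioi i) 1 * h1

/-- The product with constant `1` in `wtD` is designed for this cancellation against the translated
denominator of `wtX`; it makes `∂̄ᵢxⁱ` act as multiplication by `frac i (w i)`. -/
theorem wtD_mul_shift_wtX (w : Fin n → Polynomial K) (i : Fin n) :
    wtD w i * shift K n (Pi.single i 1) (wtX i) = frac i (w i) := by
  rw [shift_wtX, shift_self_linProd i (by simp), wtD, zero_add, mul_assoc,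
    Ring.mul_inverse_cancel _ (isUnit_linProd_Ioi i 1), mul_one]

theorem wtX_mul_shift_wtD (w : Fin n → Polynomial K) (i : Fin n) :
    wtX i * shift K n (Pi.single i (-1)) (wtD w i) =
      shift K n (Pi.single i (-1)) (frac i (w i)) := by
  rw [wtD, map_mul, shift_self_linProd i (by simp), wtX, mul_comm, mul_assoc, add_neg_cancel,
    Ring.mul_inverse_cancel _ (isUnit_linProd_Ioi i 0), mul_one]

theorem hh_swap (i j : Fin n) : hh K n i j = - hh K n j i := by simp [hh]

/-- The operators by which the generators act on `Ū(n)`. -/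
def genAct (w : Fin n → Polynomial K) : Gen K n → Module.End K (UBar K n)
  | .u f => act f 0
  | .x i => act (wtX i) (Pi.single i (-1))
  | .d i => act (wtD w i) (Pi.single i 1)

/-- For `j ≠ i`, `shift_frac_mul` gives the difference as `frac j (w j) / (1 - h̃ᵢⱼ)`; for `j = i`
this coefficient is `1`. The result is the relation for `xⁱ∂̄ᵢ` read in the representation. -/
theorem delta_sum_frac (w : Fin n → Polynomial K) (i : Fin n) :
    Delta K n i (∑ j, frac j (w j)) =
      (∑ j, Ring.inverse (1 - hh K n i j) * frac j (w j)) -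
        shift K n (Pi.single i (-1)) (frac i (w i)) := by
  have key : ∀ j ∈ univ.erase i, frac j (w j) - shift K n (Pi.single i (-1)) (frac j (w j)) =
      Ring.inverse (1 - hh K n i j) * frac j (w j) := by
    intro j hj
    have hji := ne_of_mem_erase hj
    have h1 := shift_frac_mul hji (-1) (w j)
    have hu : IsUnit (1 - hh K n i j) := by
      have := isUnit_hh_add K n j i hji 1
      rw [hh_swap j i] at this
      convert this using 1
      push_cast; ring
    rw [eq_comm, Ring.inverse_mul_eq_iff_eq_mul _ _ _ hu, hh_swap i j]
    rw [Int.cast_neg, Int.cast_one] at h1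
    linear_combination h1
  rw [Delta, ← Pi.single_neg, map_sum, ← sum_sub_distrib,
    ← add_sum_erase _ _ (mem_univ i), sum_congr rfl key, ← add_sum_erase univ _ (mem_univ i)]
  simp [hh]

theorem mul_ringInverse_mul_eq {y a b c : UBar K n} (hy : IsUnit y) (e : y * a = b * c) :
    a = b * Ring.inverse y * c := by
  apply hy.mul_left_cancel
  linear_combination e - b * c * Ring.mul_inverse_cancel _ hy

theorem isUnit_hh {i j : Fin n} (hij : i ≠ j) : IsUnit (hh K n i j) := by
  simpa using isUnit_hh_add K n i j hij 0

theorem genAct_d_mul_x (w : Fin n → Polynomial K) (i : Fin n) :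
    genAct w (.d i) * genAct w (.x i) = act (frac i (w i)) 0 := by
  rw [genAct, genAct, act_mul_act, wtD_mul_shift_wtX, ← Pi.single_add, add_neg_cancel,
    Pi.single_zero]

theorem genAct_x_mul_d (w : Fin n → Polynomial K) (i : Fin n) :
    genAct w (.x i) * genAct w (.d i) = act (shift K n (Pi.single i (-1)) (frac i (w i))) 0 := by
  rw [genAct, genAct, act_mul_act, wtX_mul_shift_wtD, ← Pi.single_add, neg_add_cancel,
    Pi.single_zero]

theorem genAct_u_mul (w : Fin n → Polynomial K) (f g : UBar K n) :
    genAct w (.u f) * act g 0 = act (f * g) 0 := by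
  rw [genAct, act_mul_act, shift_zero, add_zero]

theorem shift_weight_x (i j : Fin n) :
    shift K n (Pi.single j (-1)) (h K n i + if i = j then 1 else 0) = h K n i := by
  rw [map_add, shift_h]
  split_ifs with e
  · rw [e, Pi.single_eq_same, map_one, Int.cast_neg, Int.cast_one, neg_add_cancel_right]
  · rw [Pi.single_eq_of_ne e, map_zero, Int.cast_zero, add_zero, add_zero]

theorem shift_weight_d (i j : Fin n) :
    shift K n (Pi.single j 1) (h K n i - if i = j then 1 else 0) = h K n i := by
  rw [map_sub, shift_h]
  split_ifs with e
  · rw [e, Pi.single_eq_same, map_one, Int.cast_one, add_sub_cancel_right]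
  · rw [Pi.single_eq_of_ne e, map_zero, Int.cast_zero, add_zero, sub_zero]

/-- The potential enters only through its differences, so `w` is free up to changes that every `Δᵢ`
kills. -/
theorem genAct_rel (w : Fin n → Polynomial K) (s : Fin n → UBar K n)
    (hs : ∀ i, Delta K n i (∑ j, frac j (w j)) = s i) ⦃a b : FreeAlgebra K (Gen K n)⦄
    (hab : Rel K n s a b) :
    FreeAlgebra.lift K (genAct w) a = FreeAlgebra.lift K (genAct w) b := by
  cases hab with
  | add f g => simp only [map_add, FreeAlgebra.lift_ι_apply, genAct, act_add]
  | mul f g =>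
    simp only [map_mul, FreeAlgebra.lift_ι_apply, genAct, act_mul_act, shift_zero, add_zero]
  | scalar c => simp only [AlgHom.commutes, FreeAlgebra.lift_ι_apply, genAct, act_scalar]
  | weight_x i j =>
    simp only [map_mul, FreeAlgebra.lift_ι_apply, genAct, act_mul_act, zero_add, add_zero]
    rw [shift_weight_x, shift_zero, mul_comm]
  | weight_d i j =>
    simp only [map_mul, FreeAlgebra.lift_ι_apply, genAct, act_mul_act, zero_add, add_zero]
    rw [shift_weight_d, shift_zero, mul_comm]
  | xx i j hij =>
    simp only [map_mul, FreeAlgebra.lift_ι_apply, genAct, act_mul_act, zero_add]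
    rw [add_comm]
    congr 1
    have h1 := wtX_mul_shift_of_lt (K := K) hij (-1)
    rw [Int.cast_neg, Int.cast_one] at h1
    rw [shift_wtX_of_gt hij, shift_zero, shift_zero]
    refine mul_ringInverse_mul_eq (isUnit_hh hij.ne) ?_
    linear_combination -wtX j * h1
  | dd i j hij =>
    simp only [map_mul, FreeAlgebra.lift_ι_apply, genAct, act_mul_act, zero_add]
    rw [add_comm]
    congr 1
    have h1 := wtD_mul_shift_of_lt w hij 1
    have h2 := wtD_mul_shift_of_gt w hij 1
    rw [Int.cast_one] at h1 h2
    rw [shift_zero, shift_zero]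
    refine mul_ringInverse_mul_eq (isUnit_hh hij.ne) ?_
    have u1 := isUnit_hh_add K n i j hij.ne 1
    have u2 := isUnit_hh (K := K) hij.ne
    rw [Int.cast_one] at u1
    apply (u1.mul u2).mul_left_cancel
    rw [hh_swap j i] at h2
    linear_combination -hh K n i j * wtD w j * h1 - hh K n i j ^ 2 * wtD w i * h2
  | xd_lt i j hij =>
    simp only [map_mul, FreeAlgebra.lift_ι_apply, genAct, act_mul_act]
    rw [add_comm]
    congr 1
    have h1 := wtX_mul_shift_of_lt (K := K) hij 1
    have h2 := wtD_mul_shift_of_gt w hij (-1)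
    have u1 := isUnit_hh_add K n i j hij.ne (-1)
    rw [hh_swap j i] at h2
    push_cast at h1 h2 u1
    apply u1.mul_left_cancel
    linear_combination -wtX i * h2 - wtD w j * h1
  | xd_gt i j hij =>
    simp only [map_mul, FreeAlgebra.lift_ι_apply, genAct, act_mul_act, zero_add]
    rw [add_comm]
    congr 1
    have h1 := shift_wtX_of_gt (K := K) hij 1
    have h2 := wtD_mul_shift_of_lt w hij (-1)
    have u1 := isUnit_hh_add K n i j hij.ne' (-1)
    rw [hh_swap j i] at h2
    push_cast at h2 u1
    rw [← sub_eq_add_neg] at u1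
    rw [shift_zero, h1, shift_zero]
    refine mul_ringInverse_mul_eq (u1.pow 2) ?_
    linear_combination wtX i * h2
  | xd_eq i =>
    simp only [map_mul, map_sub, map_sum, FreeAlgebra.lift_ι_apply, genAct_x_mul_d, genAct_d_mul_x,
      genAct_u_mul]
    rw [← act_sum, genAct, ← act_sub, ← hs, delta_sum_frac, sub_sub_cancel]

/-- The representation of the ring on `Ū(n)` attached to a decomposition of the potential. -/
def rep (w : Fin n → Polynomial K) (σ : UBar K n)
    (hs : ∀ i, Delta K n i (∑ j, frac j (w j)) = Delta K n i σ) :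
    Diff K n σ →ₐ[K] Module.End K (UBar K n) :=
  RingQuot.liftAlgHom K ⟨FreeAlgebra.lift K (genAct w), genAct_rel w _ hs⟩

theorem rep_gen (w : Fin n → Polynomial K) (σ : UBar K n)
    (hs : ∀ i, Delta K n i (∑ j, frac j (w j)) = Delta K n i σ) (g : Gen K n) :
    rep w σ hs (gen K n σ g) = genAct w g := by
  simp [rep, gen]

/-! ### Decompositions of potentials into fractions -/

theorem frac_add (i : Fin n) (p q : Polynomial K) : frac i (p + q) = frac i p + frac i q := by
  simp [frac, add_mul]

theorem frac_smul (i : Fin n) (a : K) (p : Polynomial K) : frac i (a • p) = a • frac i p := by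
  simp [frac]

theorem frac_zero (i : Fin n) : frac i (0 : Polynomial K) = 0 := by
  simp [frac]

/-- The points `h̃ᵢ` in the field of fractions. -/
def hFrac (i : Fin n) : FractionRing (UBar K n) := algebraMap (UBar K n) _ (h K n i)

theorem hFrac_injective : Function.Injective (hFrac (K := K) (n := n)) :=
  (IsFractionRing.injective (UBar K n) (FractionRing (UBar K n))).comp h_injective

theorem algebraMap_sum_frac_X_pow (m : ℕ) :
    algebraMap (UBar K n) (FractionRing (UBar K n)) (∑ j, frac j (Polynomial.X ^ m)) =
      divDiff hFrac m := by
  rw [map_sum, divDiff]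
  refine sum_congr rfl fun j _ => ?_
  rw [frac, map_mul, map_inverse_of_isUnit _ (isUnit_chi K n j), Ring.inverse_eq_inv,
    div_eq_mul_inv, chi, map_prod]
  simp [hFrac, hh]

theorem sum_frac_X_pow_of_lt {m : ℕ} (hm : m < n) :
    ∑ j : Fin n, frac j (Polynomial.X ^ m : Polynomial K) = if m = n - 1 then 1 else 0 := by
  apply IsFractionRing.injective (UBar K n) (FractionRing (UBar K n))
  rw [algebraMap_sum_frac_X_pow, divDiff_of_lt hFrac_injective (by simpa using hm),
    Fintype.card_fin]
  split_ifs <;> simp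

theorem sum_frac_X_pow_add (k : ℕ) [NeZero n] :
    ∑ j : Fin n, frac j (Polynomial.X ^ (k + (n - 1)) : Polynomial K) =
      algebraMap (U K n) (UBar K n) (hsymm (Fin n) K k) := by
  apply IsFractionRing.injective (UBar K n) (FractionRing (UBar K n))
  rw [algebraMap_sum_frac_X_pow, ← eval_hsymm_eq_divDiff n hFrac_injective, hsymm, hsymm]
  simp only [map_sum, map_multiset_prod, Multiset.map_map, Function.comp_def, eval_X]
  rfl

/-- Every element of `𝒲'` is a sum of fractions `πⱼ(h̃ⱼ) / χⱼ` with `tⁿ ∣ π₁`. -/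
theorem exists_sum_frac_of_mem_WPrime [NeZero n] {σ : UBar K n} (hσ : σ ∈ WPrime K n) :
    ∃ π : Fin n → Polynomial K, Polynomial.X ^ n ∣ π 0 ∧ σ = ∑ j, frac j (π j) := by
  let S : Submodule K (UBar K n) :=
    { carrier := {σ | ∃ π : Fin n → Polynomial K, Polynomial.X ^ n ∣ π 0 ∧ σ = ∑ j, frac j (π j)}
      add_mem' := by
        rintro _ _ ⟨p, hp, rfl⟩ ⟨q, hq, rfl⟩
        exact ⟨p + q, dvd_add hp hq, by simp [frac_add, sum_add_distrib]⟩
      zero_mem' := ⟨0, dvd_zero _, by simp [frac_zero]⟩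
      smul_mem' := by
        rintro a _ ⟨p, hp, rfl⟩
        exact ⟨a • p, dvd_smul_of_dvd a hp, by simp [frac_smul, smul_sum]⟩ }
  have hS : WPrime K n ≤ S := by
    refine sup_le (iSup₂_le fun j hj => ?_) (Submodule.span_le.2 ?_)
    · rintro _ ⟨p, rfl⟩
      refine ⟨Pi.single j p, by simp [hj.symm], ?_⟩
      rw [sum_eq_single j]
      · simp [frac]
      · intro k _ hk
        simp [hk, frac_zero]
      · simp
    · rintro _ ⟨k, hk, rfl⟩
      -- The divisibility by `tⁿ` uses `k ≥ 1`: the excluded `H₀ = 1` would need the exponent `n -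
      -- 1`.
      refine ⟨fun _ => Polynomial.X ^ (k + (n - 1)), pow_dvd_pow _ (by omega), ?_⟩
      exact (sum_frac_X_pow_add k).symm
  exact hS hσ

/-- A Vandermonde system at the distinct nodes `h̃ⱼ`, with unknowns `aⱼ / χⱼ`. -/
theorem eq_zero_of_sum_mul_frac_X_pow {a : Fin n → UBar K n}
    (ha : ∀ k < n, ∑ j, a j * frac j (Polynomial.X ^ k : Polynomial K) = 0) : a = 0 := by
  have h0 : (fun j => a j * Ring.inverse (chi K n j)) = 0 := by
    refine Matrix.eq_zero_of_forall_pow_sum_mul_pow_eq_zero (h_injective (K := K)) fun k => ?_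
    rw [← ha k k.2]
    refine sum_congr rfl fun j _ => ?_
    simp only [frac, map_pow, Polynomial.aeval_X]
    ring
  funext j
  have := congrFun h0 j
  have hu := isUnit_chi K n j
  calc a j = a j * Ring.inverse (chi K n j) * chi K n j := by
        rw [Ring.inverse_mul_cancel_right _ _ hu]
    _ = 0 := by rw [show a j * Ring.inverse (chi K n j) = 0 from this, zero_mul]

theorem delta_add (i : Fin n) (f g : UBar K n) :
    Delta K n i (f + g) = Delta K n i f + Delta K n i g := by
  simp only [Delta, map_add]; ring

theorem delta_smul (i : Fin n) (a : K) (f : UBar K n) :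
    Delta K n i (a • f) = a • Delta K n i f := by
  simp [Delta, smul_sub]

theorem delta_sum_frac_X_pow (i : Fin n) {m : ℕ} (hm : m < n) :
    Delta K n i (∑ j : Fin n, frac j (Polynomial.X ^ m : Polynomial K)) = 0 := by
  rw [sum_frac_X_pow_of_lt hm]
  split_ifs <;> simp [Delta]

/-! ### Invariants of the translations -/

theorem eval_shiftPoly (c : Fin n → ℤ) (v : Fin n → K) (p : U K n) :
    eval v (shiftPoly K n c p) = eval (fun i => v i + (c i : K)) p := by
  induction p using MvPolynomial.induction_on with
  | C a => simp [shiftPoly]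
  | add p q hp hq => rw [map_add, map_add, map_add, hp, hq]
  | mul_X p i hp =>
    rw [map_mul, map_mul, map_mul, hp]
    simp [shiftPoly]

/-- The elements of `Ū(n)` that are invariant under all translations are the scalars. -/
theorem exists_scalar_of_shift_eq [CharZero K] {f : UBar K n}
    (hf : ∀ i, shift K n (Pi.single i (-1)) f = f) : ∃ a : K, f = algebraMap K (UBar K n) a := by
  have hstab : ∀ c : Fin n → ℤ, shift K n c f = f := by
    -- The stabilizer of `f` is a subgroup of the lattice containing the generators `-εᵢ`.
    let S : AddSubgroup (Fin n → ℤ) :=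
      { carrier := {c | shift K n c f = f}
        add_mem' := fun {c d} hc hd => by
          change shift K n (c + d) f = f
          rw [← shift_shift, show shift K n d f = f from hd, show shift K n c f = f from hc]
        zero_mem' := shift_zero f
        neg_mem' := fun {c} hc => by
          change shift K n (-c) f = f
          conv_lhs => rw [← show shift K n c f = f from hc]
          rw [shift_shift, neg_add_cancel, shift_zero] }
    intro c
    change c ∈ S
    have : c = ∑ i, (-c i) • Pi.single i (-1 : ℤ) := by
      ext k
      simp [Finset.sum_apply, Pi.single_apply]
    rw [this]
    exact sum_mem fun i _ => S.zsmul_mem (hf i) _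
  obtain ⟨⟨p, q⟩, hpq⟩ := IsLocalization.surj (denoms K n) f
  have hq0 : (q : U K n) ≠ 0 := nonZeroDivisors.ne_zero (denoms_le_nonZeroDivisors q.2)
  obtain ⟨v, hv⟩ : ∃ v, eval v (q : U K n) ≠ 0 := by
    by_contra! hcon
    exact hq0 (MvPolynomial.funext fun v => by simpa using hcon v)
  have hshift : ∀ c : Fin n → ℤ, p * shiftPoly K n c q = shiftPoly K n c p * q := by
    intro c
    apply algebraMap_injective
    have h1 := congrArg (shift K n c) hpq
    rw [map_mul, hstab, shift_algebraMap, shift_algebraMap] at h1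
    rw [map_mul, map_mul, ← h1, ← hpq]
    ring
  -- Evaluating `hshift c` at `v` shows that both sides agree on `v + ℤⁿ`, a product of infinite
  -- sets in characteristic `0`; hence `f = p/q` is the constant `p(v)/q(v)`.
  have hP : C (eval v (q : U K n)) * p = C (eval v p) * (q : U K n) := by
    refine funext_set (fun i => Set.range fun m : ℤ => v i + (m : K)) (fun i => ?_) fun x hx => ?_
    · refine Set.infinite_range_of_injective fun a b hab => ?_
      exact_mod_cast add_left_cancel hab
    · choose c hc using fun i => hx i trivial
      have hx' : x = fun i => v i + (c i : K) := _root_.funext fun i => (hc i).symm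
      have := congrArg (eval v) (hshift c)
      rw [map_mul, map_mul, eval_shiftPoly, eval_shiftPoly, ← hx'] at this
      rw [map_mul, map_mul, eval_C, eval_C, this, mul_comm]
  refine ⟨eval v p / eval v (q : U K n), ?_⟩
  have hu := IsLocalization.map_units (UBar K n) q
  apply hu.mul_right_cancel
  rw [hpq, IsScalarTower.algebraMap_apply K (U K n) (UBar K n), ← map_mul]
  congr 1
  have hC : C (eval v (q : U K n)) ≠ (0 : U K n) := by simpa using hv
  apply mul_left_cancel₀ hC
  change C (eval v (q : U K n)) * p = _
  rw [hP, MvPolynomial.algebraMap_eq, ← mul_assoc, ← C_mul, mul_div_cancel₀ _ hv]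

/-! ### Specialization to one variable: no nonzero constants in `𝒲'` -/

/-- The values `j / (n + 1)`, whose differences are not integers. -/
def specPt (K : Type*) [Field K] {n : ℕ} (i : Fin n) : K := (i : K) / (n + 1)

/-- Otherwise `n + 1` would divide `i - j`, which is nonzero of absolute value less than `n`. -/
theorem specPt_sub_add_ne_zero [CharZero K] {i j : Fin n} (hij : i ≠ j) (k : ℤ) :
    specPt K i - specPt K j + (k : K) ≠ 0 := by
  intro h0
  have hn : (n : K) + 1 ≠ 0 := by exact_mod_cast n.succ_ne_zero
  rw [specPt, specPt] at h0
  field_simp at h0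
  have h1 : (i : ℤ) - j + k * (n + 1) = 0 := by
    have : (((i : ℤ) - j + k * (n + 1) : ℤ) : K) = 0 := by push_cast; linear_combination h0
    exact_mod_cast this
  have hi := i.2
  have hj := j.2
  have hne : (i : ℕ) ≠ j := fun e => hij (Fin.ext e)
  have hk : k = 0 := by
    by_contra hk
    rcases lt_or_gt_of_ne hk with hk | hk
    · nlinarith
    · nlinarith
  subst hk
  omega

/-- The images of the `h̃ⱼ` under `h̃₁ ↦ t`, `h̃ⱼ ↦ j / (n + 1)`. -/
def specVal (K : Type*) [Field K] {n : ℕ} [NeZero n] (i : Fin n) : Polynomial K :=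
  if i = 0 then Polynomial.X else Polynomial.C (specPt K i)

theorem specVal_sub_add_ne_zero [CharZero K] [NeZero n] {i j : Fin n} (hij : i ≠ j) (k : ℤ) :
    specVal K i - specVal K j + (k : Polynomial K) ≠ 0 := by
  intro h0
  rw [specVal, specVal] at h0
  split_ifs at h0 with h1 h2 h2
  · exact hij (h1.trans h2.symm)
  · have := congrArg (Polynomial.eval (specPt K j - k + 1)) h0
    simp only [Polynomial.eval_add, Polynomial.eval_sub, Polynomial.eval_C, Polynomial.eval_intCast,
      Polynomial.eval_zero, Polynomial.eval_X] at this
    exact one_ne_zero (by linear_combination this)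
  · have := congrArg (Polynomial.eval (specPt K i + k + 1)) h0
    simp only [Polynomial.eval_add, Polynomial.eval_sub, Polynomial.eval_C, Polynomial.eval_intCast,
      Polynomial.eval_zero, Polynomial.eval_X] at this
    exact one_ne_zero (by linear_combination -this)
  · have := congrArg (Polynomial.eval 0) h0
    simp only [Polynomial.eval_add, Polynomial.eval_sub, Polynomial.eval_C, Polynomial.eval_intCast,
      Polynomial.eval_zero] at this
    exact specPt_sub_add_ne_zero hij k this

/-- The specialization `h̃₁ ↦ t`, `h̃ⱼ ↦ j / (n + 1)` of `U(n)`. -/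
def specPoly (K : Type*) [Field K] (n : ℕ) [NeZero n] : U K n →+* RatFunc K :=
  (algebraMap (Polynomial K) (RatFunc K)).comp
    (aeval (specVal K) : U K n →ₐ[K] Polynomial K).toRingHom

theorem isUnit_specPoly [CharZero K] [NeZero n] (y : denoms K n) :
    IsUnit (specPoly K n y) := by
  have : denoms K n ≤ (IsUnit.submonoid (RatFunc K)).comap (specPoly K n) := by
    rw [denoms, Submonoid.closure_le]
    rintro p ⟨i, j, hij, k, rfl⟩
    change IsUnit _
    rw [isUnit_iff_ne_zero]
    have := specVal_sub_add_ne_zero (K := K) hij k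
    simpa [specPoly] using (map_ne_zero_iff _ (RatFunc.algebraMap_injective K)).2 this
  exact this y.2

/-- The specialization `h̃₁ ↦ t`, `h̃ⱼ ↦ j / (n + 1)`. -/
def spec [CharZero K] [NeZero n] : UBar K n →+* RatFunc K :=
  IsLocalization.lift (M := denoms K n) isUnit_specPoly

theorem spec_scalar [CharZero K] [NeZero n] (a : K) :
    spec (n := n) (algebraMap K (UBar K n) a) =
      algebraMap (Polynomial K) (RatFunc K) (Polynomial.C a) := by
  rw [IsScalarTower.algebraMap_apply K (U K n) (UBar K n), spec, IsLocalization.lift_eq]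
  simp [specPoly]

theorem spec_h [CharZero K] [NeZero n] (i : Fin n) :
    spec (h K n i) = algebraMap (Polynomial K) (RatFunc K) (specVal K i) := by
  rw [h, spec, IsLocalization.lift_eq]
  simp [specPoly]

theorem spec_aeval [CharZero K] [NeZero n] (i : Fin n) (π : Polynomial K) :
    spec (Polynomial.aeval (h K n i) π) =
      algebraMap (Polynomial K) (RatFunc K) (π.comp (specVal K i)) := by
  induction π using Polynomial.induction_on' with
  | add p q hp hq => rw [map_add, map_add, hp, hq, Polynomial.add_comp, map_add]
  | monomial m a => simp [Polynomial.aeval_monomial, spec_scalar, spec_h]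

theorem spec_frac_zero [CharZero K] [NeZero n] (π : Polynomial K) :
    spec (frac (0 : Fin n) π) *
        algebraMap (Polynomial K) (RatFunc K) (Lagrange.nodal (univ.erase (0 : Fin n)) (specPt K)) =
      algebraMap _ _ π := by
  have h1 : spec (chi K n 0) = algebraMap (Polynomial K) (RatFunc K)
      (Lagrange.nodal (univ.erase (0 : Fin n)) (specPt K)) := by
    rw [chi, Lagrange.nodal, map_prod, map_prod]
    refine prod_congr rfl fun k hk => ?_
    simp [hh, spec_h, specVal, ne_of_mem_erase hk]
  rw [frac, map_mul, spec_aeval, ← h1, mul_assoc, ← map_mul,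
    Ring.inverse_mul_cancel _ (isUnit_chi K n 0)]
  simp [specVal]

/-- After specialization the numerator is constant and the denominator is a constant times `specPt K
j - t`, which cancels one factor of the nodal polynomial up to sign. -/
theorem spec_frac_of_ne [CharZero K] [NeZero n] {j : Fin n} (hj : j ≠ 0) (π : Polynomial K) :
    ∃ d : K, spec (frac j π) *
        algebraMap (Polynomial K) (RatFunc K) (Lagrange.nodal (univ.erase (0 : Fin n)) (specPt K)) =
      algebraMap _ _ (Polynomial.C d *
        Lagrange.nodal ((univ.erase (0 : Fin n)).erase j) (specPt K)) := by
  set s := (univ.erase (0 : Fin n)).erase j with hs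
  have hjs : j ∈ univ.erase (0 : Fin n) := by simp [hj]
  have h0j : (0 : Fin n) ∈ univ.erase j := by simp [hj.symm]
  set b : K := ∏ k ∈ s, (specPt K j - specPt K k) with hb
  have hb0 : b ≠ 0 := prod_ne_zero_iff.2 fun k hk => by
    simpa using specPt_sub_add_ne_zero (K := K) (ne_of_mem_erase hk).symm 0
  have h1 : spec (chi K n j) = algebraMap (Polynomial K) (RatFunc K)
      ((Polynomial.C (specPt K j) - Polynomial.X) * Polynomial.C b) := by
    rw [chi, ← mul_prod_erase _ _ h0j, erase_right_comm, ← hs, map_mul, map_prod, map_mul, hb,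
      map_prod, map_prod]
    congr 1
    · simp [hh, spec_h, specVal, hj]
    · refine prod_congr rfl fun k hk => ?_
      simp [hh, spec_h, specVal, hj, ne_of_mem_erase (mem_of_mem_erase hk)]
  have h2 : spec (chi K n j) * spec (Ring.inverse (chi K n j)) = 1 := by
    rw [← map_mul, Ring.mul_inverse_cancel _ (isUnit_chi K n j), map_one]
  refine ⟨-(π.eval (specPt K j) / b), ?_⟩
  have h3 : spec (chi K n j) ≠ 0 := left_ne_zero_of_mul_eq_one h2
  apply mul_left_cancel₀ h3
  rw [frac, map_mul, spec_aeval, specVal, if_neg hj, Polynomial.comp_C,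
    Lagrange.nodal_eq_mul_nodal_erase hjs, ← hs]
  have h4 : (Polynomial.C (specPt K j) - Polynomial.X) * Polynomial.C b *
      (Polynomial.C (-(π.eval (specPt K j) / b)) * Lagrange.nodal s (specPt K)) =
      Polynomial.C (π.eval (specPt K j)) *
        ((Polynomial.X - Polynomial.C (specPt K j)) * Lagrange.nodal s (specPt K)) := by
    have : Polynomial.C b * Polynomial.C (-(π.eval (specPt K j) / b)) =
        - Polynomial.C (π.eval (specPt K j)) := by
      rw [← map_mul, ← map_neg]
      congr 1
      field_simp
    linear_combination (Polynomial.C (specPt K j) - Polynomial.X) *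
      Lagrange.nodal s (specPt K) * this
  have h5 := congrArg (algebraMap (Polynomial K) (RatFunc K)) h4
  rw [map_mul, ← h1, map_mul _ (Polynomial.C (π.eval _))] at h5
  linear_combination -h5 + (algebraMap (Polynomial K) (RatFunc K) (Polynomial.C (π.eval (specPt K j)))) *
    (algebraMap (Polynomial K) (RatFunc K)
      ((Polynomial.X - Polynomial.C (specPt K j)) * Lagrange.nodal s (specPt K))) * h2

theorem eq_zero_of_scalar_mem_WPrime [CharZero K] [NeZero n] {c : K}
    (hc : algebraMap K (UBar K n) c ∈ WPrime K n) : c = 0 := by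
  obtain ⟨π, hπ, h0⟩ := exists_sum_frac_of_mem_WPrime hc
  choose! d hd using fun (j : Fin n) (hj : j ≠ 0) => spec_frac_of_ne hj (π j)
  have h1 := congrArg (fun f => spec f * algebraMap (Polynomial K) (RatFunc K)
    (Lagrange.nodal (univ.erase (0 : Fin n)) (specPt K))) h0
  rw [spec_scalar, ← map_mul, ← add_sum_erase _ _ (mem_univ (0 : Fin n)), map_add, add_mul,
    spec_frac_zero, map_sum, sum_mul, sum_congr rfl fun j hj => hd j (ne_of_mem_erase hj),
    ← map_sum, ← map_add] at h1
  -- In degree `n - 1` the left side contributes `c`, as the nodal polynomial is monic of that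
  -- degree. The right side contributes nothing: `tⁿ` divides `π 0`, and the other terms have
  -- smaller degree.
  have h2 := congrArg (fun p => Polynomial.coeff p (n - 1)) (RatFunc.algebraMap_injective K h1)
  have hcard : #(univ.erase (0 : Fin n)) = n - 1 := by
    rw [card_erase_of_mem (mem_univ _), card_univ, Fintype.card_fin]
  have h3 : (Lagrange.nodal (univ.erase (0 : Fin n)) (specPt K)).coeff (n - 1) = 1 := by
    have := Lagrange.nodal_monic (s := univ.erase (0 : Fin n)) (v := specPt K)
    rwa [Polynomial.Monic, Polynomial.leadingCoeff, Lagrange.natDegree_nodal, hcard] at this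
  have h4 : (π 0).coeff (n - 1) = 0 := by
    refine Polynomial.X_pow_dvd_iff.1 hπ _ ?_
    have := NeZero.pos n
    omega
  have h5 : ∀ j ∈ univ.erase (0 : Fin n),
      (Lagrange.nodal ((univ.erase (0 : Fin n)).erase j) (specPt K)).coeff (n - 1) = 0 := by
    intro j hj
    refine Polynomial.coeff_eq_zero_of_natDegree_lt ?_
    rw [Lagrange.natDegree_nodal, ← hcard]
    exact card_erase_lt_of_mem hj
  simp only [Polynomial.coeff_add, Polynomial.finsetSum_coeff, Polynomial.coeff_C_mul, h3, h4,
    mul_one, zero_add] at h2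
  rw [h2]
  exact sum_eq_zero fun j hj => by rw [h5 j hj, mul_zero]

/-! ### Weights, the first filtration term and linear independence -/

section Relations

/-- Commutation relations with the `h̃ᵢ` extend to `Ū(n)`. -/
theorem map_mul_eq_mul_map_shift {R : Type*} [Ring R] (ι : UBar K n →+* R) (y : R)
    (c : Fin n → ℤ) (hK : ∀ a : K, ι (algebraMap K _ a) * y = y * ι (algebraMap K _ a))
    (hh : ∀ i, ι (h K n i) * y = y * ι (h K n i + (c i : UBar K n))) (f : UBar K n) :
    ι f * y = y * ι (shift K n c f) := by
  have hp : ∀ p : U K n, ι (algebraMap (U K n) (UBar K n) p) * y =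
      y * ι (shift K n c (algebraMap (U K n) (UBar K n) p)) := by
    intro p
    induction p using MvPolynomial.induction_on with
    | C a =>
      have := hK a
      rw [IsScalarTower.algebraMap_apply K (U K n) (UBar K n)] at this
      rw [shift_algebraMap]
      simpa [shiftPoly] using this
    | add p q hp hq => simp only [map_add, add_mul, mul_add, hp, hq]
    | mul_X p i hp =>
      have := hh i
      rw [← shift_h] at this
      rw [map_mul, map_mul, map_mul, map_mul, mul_assoc]
      change _ * (ι (h K n i) * y) = _
      rw [this, ← mul_assoc, hp, mul_assoc]
      rfl
  obtain ⟨⟨p, q⟩, hpq⟩ := IsLocalization.surj (denoms K n) f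
  have hu := IsLocalization.map_units (UBar K n) q
  set u := algebraMap (U K n) (UBar K n) (q : U K n) with hu'
  have hu1 := (hu.map (shift K n c)).map ι
  -- Since `R` is noncommutative, the denominator is cleared on the left and its translate on the
  -- right.
  apply hu1.mul_right_cancel
  apply (hu.map ι).mul_left_cancel
  have h1 := hp p
  have h2 := hp q
  rw [← hpq, map_mul, map_mul, map_mul] at h1
  calc ι u * (ι f * y * ι (shift K n c u)) = ι (f * u) * (y * ι (shift K n c u)) := by
        rw [mul_comm f u, map_mul]; simp only [mul_assoc]
    _ = ι (f * u) * (ι u * y) := by rw [h2]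
    _ = ι u * (ι f * ι u * y) := by
        rw [← map_mul, ← mul_assoc, ← mul_assoc, ← map_mul, ← map_mul]
        congr 2; ring
    _ = ι u * (y * (ι (shift K n c f) * ι (shift K n c u))) := by rw [h1]
    _ = _ := by simp only [mul_assoc]

variable (σ : UBar K n)

theorem coeff_apply (f : UBar K n) : coeff K n σ f = gen K n σ (.u f) := rfl

theorem coeff_scalar (a : K) :
    coeff K n σ (algebraMap K (UBar K n) a) = algebraMap K (Diff K n σ) a := by
  have := RingQuot.mkAlgHom_rel K (Rel.scalar (s := fun i => Delta K n i σ) a)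
  rwa [AlgHom.commutes] at this

theorem coeff_mul_x (i : Fin n) (f : UBar K n) :
    coeff K n σ f * gen K n σ (.x i) =
      gen K n σ (.x i) * coeff K n σ (shift K n (Pi.single i 1) f) := by
  refine map_mul_eq_mul_map_shift (coeff K n σ) _ _ (fun a => ?_) (fun j => ?_) f
  · rw [coeff_scalar, Algebra.commutes]
  · have := RingQuot.mkAlgHom_rel K (Rel.weight_x (s := fun i => Delta K n i σ) j i)
    rw [map_mul, map_mul] at this
    refine this.trans ?_
    change _ * coeff K n σ _ = _
    congr 3
    split_ifs with e
    · simp [e]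
    · simp [e]

theorem coeff_mul_d (i : Fin n) (f : UBar K n) :
    coeff K n σ f * gen K n σ (.d i) =
      gen K n σ (.d i) * coeff K n σ (shift K n (Pi.single i (-1)) f) := by
  refine map_mul_eq_mul_map_shift (coeff K n σ) _ _ (fun a => ?_) (fun j => ?_) f
  · rw [coeff_scalar, Algebra.commutes]
  · have := RingQuot.mkAlgHom_rel K (Rel.weight_d (s := fun i => Delta K n i σ) j i)
    rw [map_mul, map_mul] at this
    refine this.trans ?_
    change _ * coeff K n σ _ = _
    congr 2
    split_ifs with e
    · simp [e]; ring
    · simp [e]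

theorem x_mul_coeff (i : Fin n) (f : UBar K n) :
    gen K n σ (.x i) * coeff K n σ f =
      coeff K n σ (shift K n (Pi.single i (-1)) f) * gen K n σ (.x i) := by
  rw [coeff_mul_x, shift_shift, ← Pi.single_add, add_neg_cancel, Pi.single_zero, shift_zero]

theorem d_mul_coeff (i : Fin n) (f : UBar K n) :
    gen K n σ (.d i) * coeff K n σ f =
      coeff K n σ (shift K n (Pi.single i 1) f) * gen K n σ (.d i) := by
  rw [coeff_mul_d, shift_shift, ← Pi.single_add, neg_add_cancel, Pi.single_zero, shift_zero]

theorem x_mul_d (i : Fin n) :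
    gen K n σ (.x i) * gen K n σ (.d i) =
      (∑ j, coeff K n σ (Ring.inverse (1 - hh K n i j)) * (gen K n σ (.d j) * gen K n σ (.x j))) -
        coeff K n σ (Delta K n i σ) := by
  have := RingQuot.mkAlgHom_rel K (Rel.xd_eq (s := fun i => Delta K n i σ) i)
  simp only [map_mul, map_sub, map_sum] at this
  exact this

/-- Products of generators of degree at most one. -/
theorem prod_of_degree_le_one (l : List (Gen K n)) (hl : (l.map (Gen.deg K n)).sum ≤ 1) :
    (∃ f, (l.map (gen K n σ)).prod = coeff K n σ f) ∨
    (1 ≤ (l.map (Gen.deg K n)).sum ∧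
      ((∃ f k, (l.map (gen K n σ)).prod = coeff K n σ f * gen K n σ (.x k)) ∨
       (∃ f k, (l.map (gen K n σ)).prod = coeff K n σ f * gen K n σ (.d k)))) := by
  -- The clause on degree at least `1` is what excludes a second letter of degree `1` in the
  -- inductive steps.
  induction l with
  | nil => exact Or.inl ⟨1, by simp⟩
  | cons g l ih =>
    rw [List.map_cons, List.sum_cons] at hl
    cases g with
    | u f =>
      rw [List.map_cons, List.map_cons, List.sum_cons, List.prod_cons, ← coeff_apply]
      change 0 + _ ≤ 1 at hl
      change _ ∨ (1 ≤ 0 + _ ∧ _)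
      rcases ih (by omega) with ⟨b, hb⟩ | ⟨h1, ⟨b, k, hb⟩ | ⟨b, k, hb⟩⟩
      · exact Or.inl ⟨f * b, by rw [hb, map_mul]⟩
      · exact Or.inr ⟨by omega, Or.inl ⟨f * b, k, by rw [hb, map_mul, mul_assoc]⟩⟩
      · exact Or.inr ⟨by omega, Or.inr ⟨f * b, k, by rw [hb, map_mul, mul_assoc]⟩⟩
    | x i =>
      rw [List.map_cons, List.map_cons, List.sum_cons, List.prod_cons]
      change 1 + _ ≤ 1 at hl
      change _ ∨ (1 ≤ 1 + _ ∧ _)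
      rcases ih (by omega) with ⟨b, hb⟩ | ⟨h1, -⟩
      · exact Or.inr ⟨by omega, Or.inl ⟨_, i, by rw [hb, x_mul_coeff]⟩⟩
      · omega
    | d i =>
      rw [List.map_cons, List.map_cons, List.sum_cons, List.prod_cons]
      change 1 + _ ≤ 1 at hl
      change _ ∨ (1 ≤ 1 + _ ∧ _)
      rcases ih (by omega) with ⟨b, hb⟩ | ⟨h1, -⟩
      · exact Or.inr ⟨by omega, Or.inr ⟨_, i, by rw [hb, d_mul_coeff]⟩⟩
      · omega

theorem gen_mem_filtration (g : Gen K n) : gen K n σ g ∈ filtration K n σ 1 := by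
  refine Submodule.subset_span ⟨[g], ?_, by simp⟩
  cases g <;> simp [Gen.deg]

/-- The commutator with `h̃ᵢ`. -/
def adH (i : Fin n) : Diff K n σ →ₗ[K] Diff K n σ :=
  LinearMap.mulLeft K (coeff K n σ (h K n i)) - LinearMap.mulRight K (coeff K n σ (h K n i))

theorem adH_apply (i : Fin n) (y : Diff K n σ) :
    adH σ i y = coeff K n σ (h K n i) * y - y * coeff K n σ (h K n i) := rfl

theorem adH_coeff (i : Fin n) (f : UBar K n) : adH σ i (coeff K n σ f) = 0 := by
  rw [adH_apply, ← map_mul, ← map_mul, mul_comm, sub_self]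

theorem adH_coeff_mul_x (i k : Fin n) (f : UBar K n) :
    adH σ i (coeff K n σ f * gen K n σ (.x k)) =
      if k = i then coeff K n σ f * gen K n σ (.x k) else 0 := by
  rw [adH_apply, mul_assoc _ _ (coeff K n σ (h K n i)), x_mul_coeff, ← mul_assoc, ← mul_assoc,
    ← map_mul, ← map_mul, ← sub_mul, ← map_sub, shift_h]
  split_ifs with e
  · congr 2
    rw [e, Pi.single_eq_same]; push_cast; ring
  · rw [Pi.single_eq_of_ne (Ne.symm e), Int.cast_zero, add_zero, mul_comm, sub_self, map_zero,
      zero_mul]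

theorem adH_coeff_mul_d (i k : Fin n) (f : UBar K n) :
    adH σ i (coeff K n σ f * gen K n σ (.d k)) =
      if k = i then -(coeff K n σ f * gen K n σ (.d k)) else 0 := by
  rw [adH_apply, mul_assoc _ _ (coeff K n σ (h K n i)), d_mul_coeff, ← mul_assoc, ← mul_assoc,
    ← map_mul, ← map_mul, ← sub_mul, ← map_sub, shift_h]
  split_ifs with e
  · rw [← neg_mul (coeff K n σ f), ← map_neg]
    congr 2
    rw [e, Pi.single_eq_same]; push_cast; ring
  · rw [Pi.single_eq_of_ne (Ne.symm e), Int.cast_zero, add_zero, mul_comm, sub_self, map_zero,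
      zero_mul]

/-- The left multiples of an element by `Ū(n)`. -/
def leftSpan (y : Diff K n σ) : Submodule K (Diff K n σ) where
  carrier := {z | ∃ f, z = coeff K n σ f * y}
  add_mem' := by
    rintro _ _ ⟨f, rfl⟩ ⟨g, rfl⟩
    exact ⟨f + g, by rw [map_add, add_mul]⟩
  zero_mem' := ⟨0, by rw [map_zero, zero_mul]⟩
  smul_mem' := by
    rintro a _ ⟨f, rfl⟩
    exact ⟨algebraMap K _ a * f, by rw [map_mul, coeff_scalar, mul_assoc, Algebra.smul_def]⟩

/-- With `D = adH σ i`, the operator `D² + D` kills the weights `0` and `-1`, so it maps the first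
filtration term into `Ū(n) xⁱ`; on `y` it is multiplication by `2`. For `∂̄ᵢ` the operator is `D² -
D`. -/
theorem exists_eq_coeff_mul_x [CharZero K] {i : Fin n} {y : Diff K n σ}
    (hy : y ∈ filtration K n σ 1) (had : adH σ i y = y) :
    ∃ f, y = coeff K n σ f * gen K n σ (.x i) := by
  have key : filtration K n σ 1 ≤
      (leftSpan σ (gen K n σ (.x i))).comap (adH σ i ∘ₗ adH σ i + adH σ i) := by
    refine Submodule.span_le.2 ?_
    rintro _ ⟨l, hl, rfl⟩
    change adH σ i (adH σ i _) + adH σ i _ ∈ leftSpan σ (gen K n σ (.x i))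
    rcases prod_of_degree_le_one σ l hl with ⟨b, hb⟩ | ⟨-, ⟨b, k, hb⟩ | ⟨b, k, hb⟩⟩ <;> rw [hb]
    · simp [adH_coeff]
    · by_cases e : k = i
      · subst e
        rw [adH_coeff_mul_x, if_pos rfl, adH_coeff_mul_x, if_pos rfl]
        exact add_mem ⟨b, rfl⟩ ⟨b, rfl⟩
      · simp [adH_coeff_mul_x, e]
    · by_cases e : k = i
      · subst e
        simp [adH_coeff_mul_d]
      · simp [adH_coeff_mul_d, e]
  have h1 : adH σ i (adH σ i y) + adH σ i y ∈ leftSpan σ (gen K n σ (.x i)) := key hy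
  rw [had, had, ← two_smul K] at h1
  exact (Submodule.smul_mem_iff _ two_ne_zero).1 h1

theorem exists_eq_coeff_mul_d [CharZero K] {i : Fin n} {y : Diff K n σ}
    (hy : y ∈ filtration K n σ 1) (had : adH σ i y = -y) :
    ∃ f, y = coeff K n σ f * gen K n σ (.d i) := by
  have key : filtration K n σ 1 ≤
      (leftSpan σ (gen K n σ (.d i))).comap (adH σ i ∘ₗ adH σ i - adH σ i) := by
    refine Submodule.span_le.2 ?_
    rintro _ ⟨l, hl, rfl⟩
    change adH σ i (adH σ i _) - adH σ i _ ∈ leftSpan σ (gen K n σ (.d i))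
    rcases prod_of_degree_le_one σ l hl with ⟨b, hb⟩ | ⟨-, ⟨b, k, hb⟩ | ⟨b, k, hb⟩⟩ <;> rw [hb]
    · simp [adH_coeff]
    · by_cases e : k = i
      · subst e
        simp [adH_coeff_mul_x]
      · simp [adH_coeff_mul_x, e]
    · by_cases e : k = i
      · subst e
        rw [adH_coeff_mul_d, if_pos rfl, map_neg, adH_coeff_mul_d, if_pos rfl, neg_neg,
          sub_neg_eq_add]
        exact add_mem ⟨b, rfl⟩ ⟨b, rfl⟩
      · simp [adH_coeff_mul_d, e]
  have h1 : adH σ i (adH σ i y) - adH σ i y ∈ leftSpan σ (gen K n σ (.d i)) := key hy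
  rw [had, map_neg, had, neg_neg, sub_neg_eq_add, ← two_smul K] at h1
  exact (Submodule.smul_mem_iff _ two_ne_zero).1 h1

/-- Linear independence of `1` and the `∂̄ⱼ xʲ` over `Ū(n)`. -/
theorem eq_zero_of_sum_d_mul_x [NeZero n] (hσ : σ ∈ WPrime K n) {a₀ : UBar K n}
    {a : Fin n → UBar K n}
    (ha : coeff K n σ a₀ + ∑ j, coeff K n σ (a j) * (gen K n σ (.d j) * gen K n σ (.x j)) = 0) :
    a₀ = 0 ∧ a = 0 := by
  obtain ⟨π, -, hπ⟩ := exists_sum_frac_of_mem_WPrime hσ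
  have key : ∀ w : Fin n → Polynomial K,
      (∀ i, Delta K n i (∑ j, frac j (w j)) = Delta K n i σ) →
      a₀ + ∑ j, a j * frac j (w j) = 0 := by
    intro w hw
    have h1 := congrArg (rep w σ hw) ha
    simp only [coeff_apply, map_add, map_sum, map_mul, rep_gen, genAct_d_mul_x, genAct_u_mul,
      map_zero] at h1
    rw [← act_sum, genAct, ← act_add] at h1
    -- In the representation the whole relation is a multiplication operator, recovered from its
    -- value at `1`.
    have h2 := LinearMap.congr_fun h1 1
    rwa [act_apply, map_one, mul_one, LinearMap.zero_apply] at h2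
  have h0 := key π fun i => by rw [hπ]
  have ha0 : a = 0 := by
    refine eq_zero_of_sum_mul_frac_X_pow (K := K) fun k hk => ?_
    -- Subtracting the relation for `π` from the one for `π + tᵏ` leaves the Vandermonde system for
    -- `a`.
    have h1 := key (fun j => π j + Polynomial.X ^ k) fun i => by
      simp only [frac_add, sum_add_distrib]
      rw [delta_add, delta_sum_frac_X_pow i hk, add_zero, hπ]
    simp only [frac_add, mul_add, sum_add_distrib] at h1
    linear_combination h1 - h0
  refine ⟨?_, ha0⟩
  simpa [ha0] using h0

end Relations

/-! ### Rescaling isomorphisms -/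

/-- The images of the generators under rescaling of the `xⁱ` by `c`. -/
def scaleGen (c : K) (σ' : UBar K n) : Gen K n → Diff K n σ'
  | .u f => gen K n σ' (.u f)
  | .x i => c • gen K n σ' (.x i)
  | .d i => gen K n σ' (.d i)

/-- Every relation is homogeneous in the `xⁱ` except the one for `xⁱ∂̄ᵢ`, whose constant term
absorbs the factor `c` through the potential `c • σ'`. -/
theorem scaleGen_rel (c : K) (σ' : UBar K n) ⦃a b : FreeAlgebra K (Gen K n)⦄
    (hab : Rel K n (fun i => Delta K n i (c • σ')) a b) :
    FreeAlgebra.lift K (scaleGen c σ') a = FreeAlgebra.lift K (scaleGen c σ') b := by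
  have rel := fun {a b : FreeAlgebra K (Gen K n)}
    (h : Rel K n (fun i => Delta K n i σ') a b) => RingQuot.mkAlgHom_rel K h
  cases hab with
  | add f g =>
    simp only [map_add, FreeAlgebra.lift_ι_apply]
    exact (coeff K n σ').map_add f g
  | mul f g =>
    simp only [map_mul, FreeAlgebra.lift_ι_apply]
    exact (coeff K n σ').map_mul f g
  | scalar a =>
    simp only [AlgHom.commutes, FreeAlgebra.lift_ι_apply]
    exact coeff_scalar σ' a
  | weight_x i j =>
    have := rel (Rel.weight_x i j)
    simp only [map_mul] at this
    simp only [map_mul, FreeAlgebra.lift_ι_apply, scaleGen, mul_smul_comm, smul_mul_assoc]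
    exact congrArg (c • ·) this
  | weight_d i j =>
    have := rel (Rel.weight_d i j)
    simp only [map_mul] at this
    simp only [map_mul, FreeAlgebra.lift_ι_apply, scaleGen]
    exact this
  | xx i j hij =>
    have := rel (Rel.xx i j hij)
    rw [map_mul, map_mul, map_mul] at this
    rw [map_mul, map_mul, map_mul]
    simp only [FreeAlgebra.lift_ι_apply, scaleGen, mul_smul_comm, smul_mul_assoc]
    exact congrArg (fun y => c • c • y) this
  | dd i j hij =>
    have := rel (Rel.dd i j hij)
    rw [map_mul, map_mul, map_mul] at this
    rw [map_mul, map_mul, map_mul]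
    simp only [FreeAlgebra.lift_ι_apply, scaleGen]
    exact this
  | xd_lt i j hij =>
    have := rel (Rel.xd_lt i j hij)
    rw [map_mul, map_mul] at this
    rw [map_mul, map_mul]
    simp only [FreeAlgebra.lift_ι_apply, scaleGen, mul_smul_comm, smul_mul_assoc]
    exact congrArg (c • ·) this
  | xd_gt i j hij =>
    have := rel (Rel.xd_gt i j hij)
    rw [map_mul, map_mul, map_mul] at this
    rw [map_mul, map_mul, map_mul]
    simp only [FreeAlgebra.lift_ι_apply, scaleGen, mul_smul_comm, smul_mul_assoc]
    exact congrArg (c • ·) this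
  | xd_eq i =>
    have h1 : gen K n σ' (.u (Delta K n i (c • σ'))) = c • gen K n σ' (.u (Delta K n i σ')) := by
      rw [← coeff_apply, ← coeff_apply, delta_smul, Algebra.smul_def, map_mul, coeff_scalar,
        Algebra.smul_def]
    have := congrArg (c • ·) (x_mul_d σ' i)
    simp only [smul_sub, smul_sum, coeff_apply] at this
    simp only [map_mul, map_sub, map_sum, FreeAlgebra.lift_ι_apply, scaleGen, mul_smul_comm,
      smul_mul_assoc]
    rw [h1, this]

/-- Rescaling of the `xⁱ`. -/
def scale (c : K) (σ σ' : UBar K n) (hσ : σ = c • σ') : Diff K n σ →ₐ[K] Diff K n σ' :=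
  RingQuot.liftAlgHom K ⟨FreeAlgebra.lift K (scaleGen c σ'), fun _ _ hab =>
    scaleGen_rel c σ' (hσ ▸ hab)⟩

theorem scale_gen (c : K) (σ σ' : UBar K n) (hσ : σ = c • σ') (g : Gen K n) :
    scale c σ σ' hσ (gen K n σ g) = scaleGen c σ' g := by
  simp [scale, gen]

theorem scale_scale {c d : K} (hcd : c * d = 1) (σ σ' : UBar K n) (hσ : σ = c • σ')
    (hσ' : σ' = d • σ) (y : Diff K n σ) : scale d σ' σ hσ' (scale c σ σ' hσ y) = y := by
  have : (scale d σ' σ hσ').comp (scale c σ σ' hσ) = AlgHom.id K _ := by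
    refine RingQuot.ringQuot_ext' K _ _ (FreeAlgebra.hom_ext (funext fun g => ?_))
    change scale d σ' σ hσ' (scale c σ σ' hσ (gen K n σ g)) = gen K n σ g
    rw [scale_gen]
    cases g with
    | u f => exact scale_gen _ _ _ _ _
    | x i =>
      rw [scaleGen, map_smul, scale_gen, scaleGen, smul_smul, hcd, one_smul]
    | d i => exact scale_gen _ _ _ _ _
  exact AlgHom.congr_fun this y

theorem scale_mem_filtration (c : K) (σ σ' : UBar K n) (hσ : σ = c • σ') (k : ℕ)
    {y : Diff K n σ} (hy : y ∈ filtration K n σ k) :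
    scale c σ σ' hσ y ∈ filtration K n σ' k := by
  have hl : ∀ l : List (Gen K n), ∃ a : K,
      scale c σ σ' hσ (l.map (gen K n σ)).prod = a • (l.map (gen K n σ')).prod := by
    intro l
    induction l with
    | nil => exact ⟨1, by simp⟩
    | cons g l ih =>
      obtain ⟨a, ha⟩ := ih
      rw [List.map_cons, List.map_cons, List.prod_cons, List.prod_cons, map_mul, ha, scale_gen]
      cases g with
      | u f => exact ⟨a, mul_smul_comm _ _ _⟩
      | x i => exact ⟨a * c, by rw [scaleGen, mul_smul_comm, smul_mul_assoc, smul_smul]⟩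
      | d i => exact ⟨a, mul_smul_comm _ _ _⟩
  have key : filtration K n σ k ≤
      (filtration K n σ' k).comap (scale c σ σ' hσ).toLinearMap := by
    refine Submodule.span_le.2 ?_
    rintro _ ⟨l, hlk, rfl⟩
    obtain ⟨a, ha⟩ := hl l
    change scale c σ σ' hσ _ ∈ filtration K n σ' k
    rw [ha]
    exact Submodule.smul_mem _ _ (Submodule.subset_span ⟨l, hlk, rfl⟩)
  exact key hy

theorem filteredIso_of_eq_smul {σ σ' : UBar K n} {γ : K} (hγ : γ ≠ 0) (h : σ' = γ • σ) :
    FilteredIso K n σ σ' := by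
  have hσ : σ = γ⁻¹ • σ' := by rw [h, smul_smul, inv_mul_cancel₀ hγ, one_smul]
  have e1 := scale_scale (inv_mul_cancel₀ hγ) σ σ' hσ h
  have e2 := scale_scale (mul_inv_cancel₀ hγ) σ' σ h hσ
  refine ⟨RingEquiv.ofRingHom (scale _ σ σ' hσ).toRingHom (scale _ σ' σ h).toRingHom
    (RingHom.ext e2) (RingHom.ext e1), fun f => scale_gen _ _ _ _ _, fun k y => ⟨fun hy => ?_,
    scale_mem_filtration _ _ _ hσ k⟩⟩
  rw [← e1 y]
  exact scale_mem_filtration _ _ _ h k hy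

/-! ### Rigidity of filtered isomorphisms -/

theorem isUnit_one_sub_hh (i j : Fin n) : IsUnit (1 - hh K n i j) := by
  by_cases hij : i = j
  · simp [hij, hh]
  · have := isUnit_hh_add K n j i (Ne.symm hij) 1
    rw [hh_swap j i] at this
    convert this using 1
    push_cast; ring

theorem exists_eq_smul_of_filteredIso [CharZero K] [NeZero n] {σ σ' : UBar K n}
    (hσ : σ ∈ WPrime K n) (hσ' : σ' ∈ WPrime K n) (hiso : FilteredIso K n σ σ') :
    ∃ γ : K, γ ≠ 0 ∧ σ' = γ • σ := by
  obtain ⟨φ, hφ, hfil⟩ := hiso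
  have had : ∀ i y, adH σ' i (φ y) = φ (adH σ i y) := fun i y => by
    rw [adH_apply, adH_apply, map_sub, map_mul, map_mul, hφ]
  -- As `φ` fixes the `h̃ᵢ`, the image of `xⁱ` keeps weight `1` and stays in the first filtration
  -- term.
  choose μ hμ using fun i => exists_eq_coeff_mul_x σ' (i := i)
    ((hfil 1 _).2 (gen_mem_filtration σ (.x i))) (by
      rw [had]
      have := adH_coeff_mul_x σ i i 1
      rw [if_pos rfl, map_one, one_mul] at this
      rw [this])
  choose ν hν using fun i => exists_eq_coeff_mul_d σ' (i := i)
    ((hfil 1 _).2 (gen_mem_filtration σ (.d i))) (by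
      rw [had]
      have := adH_coeff_mul_d σ i i 1
      rw [if_pos rfl, map_one, one_mul] at this
      rw [this, map_neg])
  set A : Fin n → UBar K n := fun j => ν j * shift K n (Pi.single j 1) (μ j) with hA
  have hdx : ∀ j, φ (gen K n σ (.d j) * gen K n σ (.x j)) =
      coeff K n σ' (A j) * (gen K n σ' (.d j) * gen K n σ' (.x j)) := fun j => by
    rw [map_mul, hν, hμ, mul_assoc, ← mul_assoc (gen K n σ' (.d j)), d_mul_coeff, hA, map_mul]
    simp only [mul_assoc]
  have hxd : ∀ j, φ (gen K n σ (.x j) * gen K n σ (.d j)) =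
      coeff K n σ' (shift K n (Pi.single j (-1)) (A j)) *
        (gen K n σ' (.x j) * gen K n σ' (.d j)) := fun j => by
    rw [map_mul, hν, hμ, mul_assoc, ← mul_assoc (gen K n σ' (.x j)), x_mul_coeff]
    simp only [hA]
    rw [map_mul, shift_shift, ← Pi.single_add, neg_add_cancel, Pi.single_zero, shift_zero,
      mul_comm, map_mul]
    simp only [mul_assoc]
  have hrel : ∀ i, Delta K n i σ = shift K n (Pi.single i (-1)) (A i) * Delta K n i σ' ∧
      ∀ j, shift K n (Pi.single i (-1)) (A i) = A j := by
    intro i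
    set B := shift K n (Pi.single i (-1)) (A i) with hB
    have h1 := congrArg φ (x_mul_d σ i)
    rw [hxd, x_mul_d, map_sub, map_sum, hφ, mul_sub, mul_sum] at h1
    simp only [map_mul φ (coeff K n σ _), hφ, hdx, ← mul_assoc (coeff K n σ' _) (coeff K n σ' _),
      ← map_mul (coeff K n σ')] at h1
    -- These are the coefficients of the difference between the two expansions of `φ (xⁱ∂̄ᵢ)`.
    have h2 := eq_zero_of_sum_d_mul_x σ' hσ' (a₀ := Delta K n i σ - B * Delta K n i σ')
      (a := fun j => B * Ring.inverse (1 - hh K n i j) - Ring.inverse (1 - hh K n i j) * A j) (by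
        simp only [map_sub, sub_mul, sum_sub_distrib]
        rw [sub_eq_iff_eq_add] at h1
        rw [h1]
        abel)
    refine ⟨sub_eq_zero.1 h2.1, fun j => ?_⟩
    have h3 := congrFun h2.2 j
    have hu := isUnit_one_sub_hh (K := K) i j
    have h4 := Ring.mul_inverse_cancel _ hu
    have h5 : B * Ring.inverse (1 - hh K n i j) - Ring.inverse (1 - hh K n i j) * A j = 0 := h3
    linear_combination (1 - hh K n i j) * h5 - (B - A j) * h4
  have hAA : ∀ i, A i = A 0 := fun i => ((hrel i).2 i).symm.trans ((hrel i).2 0)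
  obtain ⟨a, ha⟩ := exists_scalar_of_shift_eq (f := A 0) fun i => by
    have := (hrel i).2 0
    rwa [hAA i] at this
  have hΔ : ∀ i, Delta K n i (σ + (-a) • σ') = 0 := fun i => by
    rw [delta_add, delta_smul, (hrel i).1, (hrel i).2 0, ha, Algebra.smul_def, map_neg]
    ring
  obtain ⟨b, hb⟩ := exists_scalar_of_shift_eq (f := σ + (-a) • σ') fun i => by
    have := hΔ i
    rw [Delta, ← Pi.single_neg, sub_eq_zero] at this
    exact this.symm
  have hb0 : b = 0 := eq_zero_of_scalar_mem_WPrime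
    (hb ▸ add_mem hσ (Submodule.smul_mem _ _ hσ'))
  have hσa : σ = a • σ' := by
    rw [hb0, map_zero, Algebra.smul_def, map_neg] at hb
    rw [Algebra.smul_def]
    linear_combination hb
  have ha0 : a ≠ 0 := by
    rintro rfl
    -- If `a = 0`, injectivity of `φ` forces `∂̄₁x¹ = 0` in the source, against linear independence.
    have h1 := hdx 0
    rw [ha, map_zero, map_zero, zero_mul, map_eq_zero_iff φ φ.injective] at h1
    have h2 := eq_zero_of_sum_d_mul_x σ hσ (a₀ := 0) (a := Pi.single 0 1) (by
      rw [map_zero, zero_add]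
      refine sum_eq_zero fun j _ => ?_
      by_cases hj : j = 0
      · rw [hj, h1, mul_zero]
      · rw [Pi.single_eq_of_ne hj, map_zero, zero_mul])
    have h3 := congrFun h2.2 0
    rw [Pi.single_eq_same] at h3
    exact one_ne_zero h3
  exact ⟨a⁻¹, inv_ne_zero ha0, by rw [hσa, smul_smul, inv_mul_cancel₀ ha0, one_smul]⟩

end

end HDiff

theorem mainTheorem8 {K : Type*} [Field K] [IsAlgClosed K] [CharZero K] (n : ℕ) [NeZero n]
    (σ σ' : HDiff.UBar K n) (hσ : σ ∈ HDiff.WPrime K n) (hσ' : σ' ∈ HDiff.WPrime K n) :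
    HDiff.FilteredIso K n σ σ' ↔ ∃ γ : K, γ ≠ 0 ∧ σ' = γ • σ :=
  ⟨HDiff.exists_eq_smul_of_filteredIso hσ hσ', fun ⟨_, hγ, h⟩ =>
    HDiff.filteredIso_of_eq_smul hγ h⟩
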